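/- Let $G = H_3(\mathbb{Z})$ be the Heisenberg group, that is, $\mathbb{Z}^3$ with the product $(x_0,y_0,z_0)(x,y,z) = (x_0+x,\, y_0+y,\, z_0+z+x_0y)$, and put $a = (1,0,0)$, $b = (0,1,0)$. Let $\mu_0 = \delta_{a^{-1}} + \delta_{b^{-1}}$ be the southwest measure on $G$. A function $h : G \to \mathbb{R}$ is $\mu_0$-harmonic if $h(g) = h(a^{-1}g) + h(b^{-1}g)$ for all $g \in G$, equivalently $h(x,y,z) = h(x-1,y,z-y) + h(x,y-1,z)$ for all $(x,y,z) \in \mathbb{Z}^3$. It is positive if $h(g) \ge 0$ for all $g \in G$ and $h \neq 0$. A positive $\mu_0$-harmonic function is extremal if it cannot be written as the sum of two non-proportional positive $\mu_0$-harmonic functions; here two positive functions are proportional if one is a positive constant times the other. For $y, z \in \mathbb{Z}$ let $p_y(z)$ be the number of partitions of $z$ with at most $y$ rows (that is, at most $y$ parts), with $p_y(z) = 0$ if $y < 0$ or $z < 0$, and $p_0(z) = 1$ if $z = 0$ and $p_0(z) = 0$ otherwise. Let $h_0(x,y,z) = p_y(z)$ and $h_1(x,y,z) = p_x(xy-z)$,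 and for $g_0 \in G$ let $\rho_{g_0}(g) = g g_0$. **Theorem 1.1.** A function $h : G \to \mathbb{R}$ is an extremal positive $\mu_0$-harmonic function if and only if it is proportional, with a positive constant, to one of the following functions: 1. a harmonic character $(x,y,z) \mapsto r^x s^y$ with $r, s > 0$ and $\frac1r + \frac1s = 1$; 2. a translate $h_0 \circ \rho_{g_0}$ with $g_0 \in G$; 3. a translate $h_1 \circ \rho_{g_0}$ with $g_0 \in G$. -/

import Mathlib

/-- The Heisenberg group `H₃(ℤ)`: the triple `(x, y, z)` stands for the upper triangular unipotent
matrix with rows `(1, x, z)`, `(0, 1, y)`, `(0, 0, 1)`. -/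
@[ext]
structure Heisenberg where
  x : ℤ
  y : ℤ
  z : ℤ

namespace Heisenberg

instance : One Heisenberg := ⟨⟨0, 0, 0⟩⟩

/-- The product of matrices, in coordinates. -/
instance : Mul Heisenberg := ⟨fun g h => ⟨g.x + h.x, g.y + h.y, g.z + h.z + g.x * h.y⟩⟩

instance : Inv Heisenberg := ⟨fun g => ⟨-g.x, -g.y, g.x * g.y - g.z⟩⟩

@[simp] theorem one_x : (1 : Heisenberg).x = 0 := rfl
@[simp] theorem one_y : (1 : Heisenberg).y = 0 := rfl
@[simp] theorem one_z : (1 : Heisenberg).z = 0 := rfl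
@[simp] theorem mul_x (g h : Heisenberg) : (g * h).x = g.x + h.x := rfl
@[simp] theorem mul_y (g h : Heisenberg) : (g * h).y = g.y + h.y := rfl
@[simp] theorem mul_z (g h : Heisenberg) : (g * h).z = g.z + h.z + g.x * h.y := rfl
@[simp] theorem inv_x (g : Heisenberg) : g⁻¹.x = -g.x := rfl
@[simp] theorem inv_y (g : Heisenberg) : g⁻¹.y = -g.y := rfl
@[simp] theorem inv_z (g : Heisenberg) : g⁻¹.z = g.x * g.y - g.z := rfl

instance : Group Heisenberg :=
  Group.ofLeftAxioms
    (fun f g h => by ext <;> simp <;> ring)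
    (fun g => by ext <;> simp)
    (fun g => by ext <;> simp)

/-- The generator `a = (1, 0, 0)`. -/
def a : Heisenberg := ⟨1, 0, 0⟩

/-- The generator `b = (0, 1, 0)`. -/
def b : Heisenberg := ⟨0, 1, 0⟩

/-- The southwest measure `μ₀ = δ_{a⁻¹} + δ_{b⁻¹}`; a finitely supported measure on the (discrete)
group is given by the mass of each point. -/
noncomputable def southwest : Heisenberg →₀ ℝ :=
  Finsupp.single a⁻¹ 1 + Finsupp.single b⁻¹ 1

/-- The operator `P_μ f (g) = ∑ₛ μ(s) f(s g)` of a finitely supported measure `μ`. -/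
noncomputable def avg (μ : Heisenberg →₀ ℝ) (f : Heisenberg → ℝ) (g : Heisenberg) : ℝ :=
  μ.sum fun s m => m * f (s * g)

/-- `h` is `μ`-harmonic: `h = P_μ h`. -/
def IsHarmonic (μ : Heisenberg →₀ ℝ) (h : Heisenberg → ℝ) : Prop :=
  ∀ g, h g = avg μ h g

/-- `h` is a positive `μ`-harmonic function; positive means nonnegative and not identically
zero. -/
def IsPositiveHarmonic (μ : Heisenberg →₀ ℝ) (h : Heisenberg → ℝ) : Prop :=
  (∀ g, 0 ≤ h g) ∧ h ≠ 0 ∧ IsHarmonic μ h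

/-- Proportionality of positive functions. -/
def Proportional (f h : Heisenberg → ℝ) : Prop :=
  ∃ c : ℝ, 0 < c ∧ ∀ g, f g = c * h g

/-- A positive `μ`-harmonic function is extremal if it is not the sum of two non-proportional
positive `μ`-harmonic functions. -/
def IsExtremal (μ : Heisenberg →₀ ℝ) (h : Heisenberg → ℝ) : Prop :=
  IsPositiveHarmonic μ h ∧
    ∀ h' h'' : Heisenberg → ℝ, IsPositiveHarmonic μ h' → IsPositiveHarmonic μ h'' →
      h = h' + h'' → Proportional h' h''

/-- `p_y(z)`: the number of partitions of the integer `z` with at most `y` rows (parts); it is `0`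
when `y < 0` or `z < 0`. -/
def partitionCount (y z : ℤ) : ℕ :=
  if 0 ≤ y ∧ 0 ≤ z then
    Fintype.card {P : Nat.Partition z.toNat // P.parts.card ≤ y.toNat}
  else 0

/-- The right translation `ρ_{g₀} : g ↦ g g₀`. -/
def rightTranslation (g₀ g : Heisenberg) : Heisenberg := g * g₀

/-- The character `(x, y, z) ↦ r ^ x * s ^ y`. -/
noncomputable def character (r s : ℝ) (g : Heisenberg) : ℝ := r ^ g.x * s ^ g.y

/-- `h₀(x, y, z) = p_y(z)`. -/
def h₀ (g : Heisenberg) : ℝ := partitionCount g.y g.z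

/-- `h₁(x, y, z) = p_x(xy - z)`. -/
def h₁ (g : Heisenberg) : ℝ := partitionCount g.x (g.x * g.y - g.z)

end Heisenberg

/-! Extremality of `h` means that every harmonic `u` with `0 ≤ u ≤ h` is a multiple of `h`
(`IsMinimal`). A nonnegative harmonic `h` assigns to `g` a measure of total mass `h g` on infinite
paths from `g` with steps `a⁻¹`, `b⁻¹`: the paths that begin by going from `g` to `w * g` along a
given word have mass `h (w * g)`.

The listed functions are minimal. A harmonic function dominated by `h₀` is determined by its values
on the row `y = 0`, where it is a multiple of `h₀`; `h₁` is the image of `h₀` under the automorphism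
`swap`. For a character, dividing by it turns the claim into a Liouville property: bounded harmonic
functions of a random walk on the group are constant.

Conversely let `h` be minimal. If some path ending in `a⁻¹, a⁻¹, …` has positive mass, then `h`
dominates a multiple of a translate of `h₀`, hence is proportional to it (`mul_h₀_le`); similarly
for `b⁻¹` and `h₁`. Otherwise group the steps in pairs. For one of the two parities of the starting
point almost every path has a mixed pair (`exists_parity`). Exchanging the two letters of the first
mixed pair moves the rest of the path by the central element `c`, so that `h = Q + Q ∘ c⁻¹` with `Q`
harmonic for two steps. Minimality makes `Q` a multiple of `h`, and `c` acts on `h` by a scalar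
(`exists_central_scalar`). Commuting powers of `a⁻¹` past `b⁻¹` shows that this scalar is at most 1
(`central_scalar_le_one`), and `swap` gives the reverse bound. Now `h` is `c`-invariant, its
translate by `a⁻¹` is again harmonic and at most `h`, so minimality makes `h` a character. -/

open Filter Topology

namespace Heisenberg

/-! ### Partitions with a bounded number of parts -/

/-- Removing one cell from each of the `k` parts. -/
def partitionEquiv (m k : ℕ) :
    {P : Nat.Partition (m + k) // P.parts.card = k} ≃
      {Q : Nat.Partition m // Q.parts.card ≤ k} where
  toFun P := ⟨Nat.Partition.ofSums m (P.1.parts.map Nat.pred) (by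
      have h1 : (P.1.parts.map fun i => Nat.pred i + 1).sum = m + k := by
        rw [Multiset.map_congr rfl (g := id)]
        · simpa using P.1.parts_sum
        · intro i hi
          exact Nat.succ_pred_eq_of_pos (P.1.parts_pos hi)
      rw [Multiset.sum_map_add] at h1
      simp [P.2] at h1
      exact h1), by
    refine (Multiset.card_le_card (Multiset.filter_le _ _)).trans ?_
    simp [P.2]⟩
  invFun Q := ⟨⟨Q.1.parts.map Nat.succ + Multiset.replicate (k - Q.1.parts.card) 1, by
      intro i hi
      rcases Multiset.mem_add.1 hi with hi | hi
      · obtain ⟨j, -, rfl⟩ := Multiset.mem_map.1 hi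
        exact Nat.succ_pos j
      · rw [Multiset.eq_of_mem_replicate hi]; exact one_pos, by
      have h1 : (Q.1.parts.map fun i => i + 1).sum = m + Q.1.parts.card := by
        rw [Multiset.sum_map_add]
        simp [Q.1.parts_sum]
      have h2 := Q.2
      simp only [Multiset.sum_add, Multiset.sum_replicate, smul_eq_mul, mul_one,
        Nat.succ_eq_add_one, h1]
      omega⟩, by
      have h2 := Q.2
      simp only [Multiset.card_add, Multiset.card_map, Multiset.card_replicate]
      omega⟩
  left_inv P := by
    have hpos : ∀ i ∈ P.1.parts, 0 < i := fun i hi => P.1.parts_pos hi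
    have hcard := P.2
    apply Subtype.ext
    apply Nat.Partition.ext
    simp only [Nat.Partition.ofSums_parts]
    generalize P.1.parts = s at hpos hcard ⊢
    -- `ofSums` discards the zeros coming from parts equal to 1. Only their number is lost, and the
    -- total count `k` restores it.
    have h1 : ((s.map Nat.pred).filter (· ≠ 0)).map Nat.succ = s.filter (· ≠ 1) := by
      rw [Multiset.filter_map, Multiset.map_map]
      rw [Multiset.map_congr rfl (g := id)]
      · rw [Multiset.map_id]
        refine Multiset.filter_congr fun i hi => ?_
        have := hpos i hi
        simp only [Function.comp, Nat.pred_eq_sub_one]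
        omega
      · intro i hi
        exact Nat.succ_pred_eq_of_pos (hpos i (Multiset.mem_of_mem_filter hi))
    have h2 : s.filter (· ≠ 1) + s.filter (· = 1) = s := by
      rw [add_comm]; exact Multiset.filter_add_not _ s
    have h3 : Multiset.card ((s.map Nat.pred).filter (· ≠ 0)) =
        Multiset.card (s.filter (· ≠ 1)) := by
      rw [← h1, Multiset.card_map]
    have h4 := congrArg Multiset.card h2
    rw [Multiset.card_add, Multiset.filter_eq', Multiset.card_replicate] at h4
    rw [h1, h3]
    conv_rhs => rw [← h2, Multiset.filter_eq']
    congr 2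
    omega
  right_inv Q := by
    apply Subtype.ext
    apply Nat.Partition.ext
    have hpos : ∀ i ∈ Q.1.parts, i ≠ 0 := fun i hi => (Q.1.parts_pos hi).ne'
    simp only [Nat.Partition.ofSums_parts, Multiset.map_add, Multiset.map_map,
      Multiset.map_replicate, Multiset.filter_add]
    have hmap : Q.1.parts.map (Nat.pred ∘ Nat.succ) = Q.1.parts :=
      (Multiset.map_congr rfl fun i _ => rfl).trans (Multiset.map_id _)
    rw [hmap, Multiset.filter_eq_self.2 hpos]
    rw [Multiset.filter_eq_nil.2]
    · simp
    · intro i hi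
      rw [Multiset.eq_of_mem_replicate hi]; simp

theorem card_partition_le_succ (k n : ℕ) :
    Fintype.card {P : Nat.Partition n // P.parts.card ≤ k + 1} =
      Fintype.card {P : Nat.Partition n // P.parts.card = k + 1} +
        Fintype.card {P : Nat.Partition n // P.parts.card ≤ k} := by
  rw [← Fintype.card_subtype_or_disjoint]
  · refine Fintype.card_congr (Equiv.subtypeEquivRight fun P => ?_)
    omega
  · rw [Pi.disjoint_iff]
    intro P
    simp only [Prop.disjoint_iff]
    omega

theorem card_parts_le {n : ℕ} (P : Nat.Partition n) : P.parts.card ≤ n := by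
  have := Multiset.card_nsmul_le_sum (s := P.parts) (a := 1) fun i hi => P.parts_pos hi
  simpa [P.parts_sum] using this

theorem partitionCount_of_neg {y z : ℤ} (hy : y < 0) : partitionCount y z = 0 :=
  if_neg fun h => by omega

theorem partitionCount_of_neg_right {y z : ℤ} (hz : z < 0) : partitionCount y z = 0 :=
  if_neg fun h => by omega

theorem partitionCount_zero (z : ℤ) : partitionCount 0 z = if z = 0 then 1 else 0 := by
  rcases lt_trichotomy z 0 with hz | rfl | hz
  · rw [partitionCount_of_neg_right hz, if_neg hz.ne]
  · rw [partitionCount, if_pos (by simp), if_pos rfl]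
    rw [Fintype.card_eq_one_iff]
    refine ⟨⟨(default : Nat.Partition 0), ?_⟩, ?_⟩
    · exact card_parts_le _
    · intro P
      apply Subtype.ext
      exact Subsingleton.elim (α := Nat.Partition 0) _ _
  · rw [partitionCount, if_pos ⟨le_rfl, hz.le⟩, if_neg hz.ne', Fintype.card_eq_zero_iff]
    refine ⟨fun P => ?_⟩
    have h1 : P.1.parts = 0 := Multiset.card_eq_zero.1 (Nat.le_zero.1 P.2)
    have h2 := P.1.parts_sum
    rw [h1] at h2
    simp at h2
    omega

/-- Partitions with exactly `y` parts become partitions of `z - y` with at most `y` parts once the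
first column of the diagram is removed; the others have at most `y - 1` parts. -/
theorem partitionCount_recurrence {y : ℤ} (hy : 0 < y) (z : ℤ) :
    partitionCount y z = partitionCount y (z - y) + partitionCount (y - 1) z := by
  rcases lt_or_ge z 0 with hz | hz
  · rw [partitionCount_of_neg_right hz, partitionCount_of_neg_right hz,
      partitionCount_of_neg_right (by omega)]
  obtain ⟨k, rfl⟩ : ∃ k : ℕ, y = k + 1 := ⟨(y - 1).toNat, by omega⟩
  have e1 : ((k : ℤ) + 1).toNat = k + 1 := by omega
  have e2 : ((k : ℤ) + 1 - 1).toNat = k := by omega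
  have h1 : partitionCount (k + 1) z =
      Fintype.card {P : Nat.Partition z.toNat // P.parts.card = k + 1} +
        partitionCount ((k : ℤ) + 1 - 1) z := by
    rw [partitionCount, if_pos ⟨hy.le, hz⟩, partitionCount, if_pos ⟨by omega, hz⟩, e1, e2]
    exact card_partition_le_succ k _
  rw [h1]
  congr 1
  rcases lt_or_ge (z - (k + 1)) 0 with hzk | hzk
  · rw [partitionCount_of_neg_right hzk, Fintype.card_eq_zero_iff]
    refine ⟨fun P => ?_⟩
    have := card_parts_le P.1
    have := P.2
    omega
  · rw [partitionCount, if_pos ⟨hy.le, hzk⟩, e1]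
    obtain ⟨m, hm⟩ : ∃ m : ℕ, z = m + (k + 1) := ⟨(z - (k + 1)).toNat, by omega⟩
    have e3 : z.toNat = m + (k + 1) := by omega
    have e4 : (z - (k + 1)).toNat = m := by omega
    rw [e3, e4]
    exact Fintype.card_congr (partitionEquiv m (k + 1))

/-! ### The Markov operator of the southwest measure -/

/-- The central element `(0, 0, 1)`. -/
def c : Heisenberg := ⟨0, 0, 1⟩

/-- The operator `P_{μ₀}`. -/
def step (f : Heisenberg → ℝ) (g : Heisenberg) : ℝ := f (a⁻¹ * g) + f (b⁻¹ * g)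

@[simp] theorem a_inv_mul (x y z : ℤ) : a⁻¹ * ⟨x, y, z⟩ = (⟨x - 1, y, z - y⟩ : Heisenberg) := by
  ext <;> simp [a] <;> ring

@[simp] theorem b_inv_mul (x y z : ℤ) : b⁻¹ * ⟨x, y, z⟩ = (⟨x, y - 1, z⟩ : Heisenberg) := by
  ext <;> simp [b]; ring

@[simp] theorem c_mul (x y z : ℤ) : c * ⟨x, y, z⟩ = (⟨x, y, z + 1⟩ : Heisenberg) := by
  ext <;> simp [c]; ring

@[simp] theorem c_inv_mul (x y z : ℤ) : c⁻¹ * ⟨x, y, z⟩ = (⟨x, y, z - 1⟩ : Heisenberg) := by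
  ext <;> simp [c]; ring

theorem mul_c_comm (g : Heisenberg) : g * c = c * g := by
  ext <;> simp [c]; ring

theorem avg_southwest (f : Heisenberg → ℝ) (g : Heisenberg) :
    avg southwest f g = step f g := by
  rw [avg, southwest, Finsupp.sum_add_index', Finsupp.sum_single_index, Finsupp.sum_single_index]
  · simp [step]
  · simp
  · simp
  · simp
  · intro s m n; ring

theorem isHarmonic_southwest_iff {h : Heisenberg → ℝ} :
    IsHarmonic southwest h ↔ ∀ g, h g = step h g := by
  simp only [IsHarmonic, avg_southwest]

/-! ### Extremality as minimality, and its invariance under symmetries -/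

/-- Every harmonic function between `0` and `h` is a multiple of `h`. -/
def IsMinimal (h : Heisenberg → ℝ) : Prop :=
  ((∀ g, 0 ≤ h g) ∧ h ≠ 0 ∧ ∀ g, h g = step h g) ∧
    ∀ u : Heisenberg → ℝ, (∀ g, 0 ≤ u g) → (∀ g, u g ≤ h g) → (∀ g, u g = step u g) →
      ∃ θ : ℝ, ∀ g, u g = θ * h g

/-- A dominated harmonic `u` gives the decomposition `h = u + (h - u)`. The cases `u = 0` and `u =
h` are separate because positive functions are nonzero. -/
theorem isExtremal_iff_isMinimal {h : Heisenberg → ℝ} :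
    IsExtremal southwest h ↔ IsMinimal h := by
  simp only [IsExtremal, IsPositiveHarmonic, isHarmonic_southwest_iff, IsMinimal]
  refine and_congr_right fun hh => ⟨fun H u hu0 huh hu => ?_, fun H h' h'' h1 h2 hs => ?_⟩
  · by_cases hz : u = 0
    · exact ⟨0, fun g => by simp [hz]⟩
    by_cases hz' : h - u = 0
    · exact ⟨1, fun g => by rw [← sub_eq_zero.1 hz', one_mul]⟩
    obtain ⟨k, hk, hk'⟩ := H u (h - u) ⟨hu0, hz, hu⟩
      ⟨fun g => sub_nonneg.2 (huh g), hz', fun g => by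
        have := hu g
        have := hh.2.2 g
        simp only [step, Pi.sub_apply] at *
        linarith⟩ (by simp)
    -- Solve `u = k * (h - u)` for `u`.
    refine ⟨k / (1 + k), fun g => ?_⟩
    have := hk' g
    simp only [Pi.sub_apply] at this
    field_simp
    linarith
  · obtain ⟨θ, hθ⟩ := H h' h1.1 (fun g => by rw [hs]; simpa using h2.1 g) h1.2.2
    have hθ' : ∀ g, h'' g = (1 - θ) * h g := fun g => by
      have := hθ g
      have := congrFun hs g
      simp only [Pi.add_apply] at this
      linarith
    obtain ⟨g, hg⟩ := Function.ne_iff.1 hh.2.1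
    have hgp : 0 < h g := lt_of_le_of_ne (hh.1 g) (Ne.symm hg)
    have h0 : 0 < θ := by
      refine lt_of_le_of_ne ?_ ?_
      · have := h1.1 g
        rw [hθ] at this
        exact nonneg_of_mul_nonneg_left this hgp
      · rintro rfl
        exact h1.2.1 (funext fun g => by simp [hθ g])
    have h0' : 0 < 1 - θ := by
      refine lt_of_le_of_ne ?_ ?_
      · have := h2.1 g
        rw [hθ'] at this
        exact nonneg_of_mul_nonneg_left this hgp
      · intro h3
        exact h2.2.1 (funext fun g => by simp [hθ' g, ← h3])
    refine ⟨θ / (1 - θ), div_pos h0 h0', fun g => ?_⟩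
    rw [hθ, hθ']
    field_simp

theorem IsMinimal.of_proportional {h k : Heisenberg → ℝ} (hk : IsMinimal k)
    (H : Proportional h k) : IsMinimal h := by
  obtain ⟨r, hr, H⟩ := H
  obtain ⟨⟨h1, h2, h3⟩, h4⟩ := hk
  refine ⟨⟨fun g => by rw [H]; exact mul_nonneg hr.le (h1 g), ?_, fun g => ?_⟩,
    fun u hu0 huh hu => ?_⟩
  · rintro rfl
    refine h2 (funext fun g => ?_)
    have := H g
    simpa [hr.ne'] using this
  · simp only [step, H]
    rw [h3 g, step]; ring
  · obtain ⟨θ, hθ⟩ := h4 (fun g => r⁻¹ * u g) (fun g => mul_nonneg (inv_nonneg.2 hr.le) (hu0 g))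
      (fun g => by
        have := huh g
        rw [H] at this
        rwa [inv_mul_le_iff₀ hr])
      (fun g => by rw [hu g]; simp only [step]; ring)
    refine ⟨θ, fun g => ?_⟩
    have := hθ g
    rw [H]
    field_simp at this
    linarith

theorem IsMinimal.comp_equiv {h : Heisenberg → ℝ} (hh : IsMinimal h)
    (e : Heisenberg ≃ Heisenberg) (he : ∀ f g, step (f ∘ e) g = step f (e g)) :
    IsMinimal (h ∘ e) := by
  obtain ⟨⟨h1, h2, h3⟩, h4⟩ := hh
  refine ⟨⟨fun g => h1 _, fun h0 => h2 (funext fun g => ?_), fun g => ?_⟩,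
    fun u hu0 huh hu => ?_⟩
  · simpa using congrFun h0 (e.symm g)
  · rw [he]; exact h3 _
  · obtain ⟨θ, hθ⟩ := h4 (u ∘ e.symm) (fun g => hu0 _) (fun g => by simpa using huh (e.symm g))
      (fun g => by
        have := he (u ∘ e.symm) (e.symm g)
        have h5 : (u ∘ e.symm) ∘ e = u := by ext; simp
        rw [h5, e.apply_symm_apply] at this
        rw [← this, Function.comp_apply, hu])
    exact ⟨θ, fun g => by simpa using hθ (e g)⟩

theorem step_comp_mulRight (g₀ : Heisenberg) (f : Heisenberg → ℝ) (g : Heisenberg) :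
    step (f ∘ Equiv.mulRight g₀) g = step f (Equiv.mulRight g₀ g) := by
  simp [step, mul_assoc]

theorem IsMinimal.comp_rightTranslation {h : Heisenberg → ℝ} (hh : IsMinimal h)
    (g₀ : Heisenberg) : IsMinimal (h ∘ rightTranslation g₀) :=
  hh.comp_equiv (Equiv.mulRight g₀) (step_comp_mulRight g₀)

/-! ### The symmetry between the two generators -/

/-- The automorphism `(x, y, z) ↦ (y, x, xy - z)` exchanging `a` and `b`. -/
def swap : Heisenberg ≃ Heisenberg where
  toFun g := ⟨g.y, g.x, g.x * g.y - g.z⟩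
  invFun g := ⟨g.y, g.x, g.x * g.y - g.z⟩
  left_inv g := by ext <;> simp; ring
  right_inv g := by ext <;> simp; ring

theorem swap_apply (g : Heisenberg) : swap g = ⟨g.y, g.x, g.x * g.y - g.z⟩ := rfl

@[simp] theorem swap_swap (g : Heisenberg) : swap (swap g) = g := swap.left_inv g

theorem swap_mul (g g' : Heisenberg) : swap (g * g') = swap g * swap g' := by
  ext <;> simp [swap_apply]; ring

theorem swap_a_inv : swap a⁻¹ = b⁻¹ := by ext <;> simp [swap_apply, a, b]
theorem swap_b_inv : swap b⁻¹ = a⁻¹ := by ext <;> simp [swap_apply, a, b]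
theorem swap_c : swap c = c⁻¹ := by ext <;> simp [swap_apply, c]

theorem step_comp_swap (f : Heisenberg → ℝ) (g : Heisenberg) :
    step (f ∘ swap) g = step f (swap g) := by
  simp only [step, Function.comp, swap_mul, swap_a_inv, swap_b_inv]
  ring

theorem h₀_comp_swap : h₀ ∘ swap = h₁ := rfl

theorem comp_swap_comp_swap (f : Heisenberg → ℝ) : (f ∘ swap) ∘ swap = f := by
  ext; simp

theorem comp_rightTranslation_comp_swap (f : Heisenberg → ℝ) (g₀ : Heisenberg) :
    (f ∘ rightTranslation g₀) ∘ swap = (f ∘ swap) ∘ rightTranslation (swap g₀) := by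
  ext; simp [rightTranslation, swap_mul]

theorem IsMinimal.comp_swap {h : Heisenberg → ℝ} (hh : IsMinimal h) : IsMinimal (h ∘ swap) :=
  hh.comp_equiv swap step_comp_swap

/-! ### Minimality of the partition functions -/

theorem h₀_eq_step (g : Heisenberg) : h₀ g = step h₀ g := by
  obtain ⟨x, y, z⟩ := g
  simp only [step, a_inv_mul, b_inv_mul, h₀]
  rcases lt_trichotomy y 0 with hy | rfl | hy
  · rw [partitionCount_of_neg hy, partitionCount_of_neg hy, partitionCount_of_neg (by omega)]
    simp
  · simp [partitionCount_of_neg (show (-1 : ℤ) < 0 by norm_num)]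
  · rw [partitionCount_recurrence hy]
    push_cast; ring

/-- Induction on `y`: once the row below vanishes, `d ⟨x, y, z⟩ = d ⟨x - 1, y, z - y⟩` with `y > 0`,
and iterating makes `z` negative, where the bound by `h₀` forces zero. -/
theorem eq_zero_of_abs_le_h₀ {d : Heisenberg → ℝ} {C : ℝ} (hd : ∀ g, d g = step d g)
    (hC : ∀ g, |d g| ≤ C * h₀ g) (h0 : ∀ x z, d ⟨x, 0, z⟩ = 0) : d = 0 := by
  have hneg : ∀ x y z, y < 0 → d ⟨x, y, z⟩ = 0 := fun x y z hy => by
    have := hC ⟨x, y, z⟩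
    simpa [h₀, partitionCount_of_neg hy] using this
  have hneg' : ∀ x y z, z < 0 → d ⟨x, y, z⟩ = 0 := fun x y z hy => by
    have := hC ⟨x, y, z⟩
    simpa [h₀, partitionCount_of_neg_right hy] using this
  have key : ∀ (k : ℕ) (x z : ℤ), d ⟨x, k, z⟩ = 0 := by
    intro k
    induction k with
    | zero => simpa using h0
    | succ k ih =>
      have aux : ∀ (n : ℕ) (x z : ℤ), z < n → d ⟨x, (k + 1 : ℕ), z⟩ = 0 := by
        intro n
        induction n with
        | zero => intro x z hz; exact hneg' _ _ _ (by simpa using hz)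
        | succ n ihn =>
          intro x z hz
          rw [hd, step, a_inv_mul, b_inv_mul]
          rw [ihn (x - 1) (z - (k + 1 : ℕ)) (by push_cast at hz ⊢; omega)]
          have := ih x z
          push_cast
          simpa using this
      intro x z
      exact aux (z.toNat + 1) x z (by omega)
  funext ⟨x, y, z⟩
  rcases lt_or_ge y 0 with hy | hy
  · exact hneg x y z hy
  · obtain ⟨k, rfl⟩ := Int.eq_ofNat_of_zero_le hy
    exact key k x z

/-- On the row `y = 0` a dominated `u` is supported on `z = 0` and does not depend on `x`, because
the row below carries no mass. So `u` agrees there with `u ⟨0, 0, 0⟩ * h₀`, and the previous lemma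
applies to the difference. -/
theorem isMinimal_h₀ : IsMinimal h₀ := by
  refine ⟨⟨fun g => Nat.cast_nonneg _, fun h => ?_, h₀_eq_step⟩, fun u hu0 huh hu => ?_⟩
  · have := congrFun h ⟨0, 0, 0⟩
    simp [h₀, partitionCount_zero] at this
  · have hneg : ∀ x y z, y < 0 → u ⟨x, y, z⟩ = 0 := fun x y z hy => by
      have := huh ⟨x, y, z⟩
      simp only [h₀, partitionCount_of_neg hy, Nat.cast_zero] at this
      exact le_antisymm this (hu0 _)
    have hconst : ∀ x z, u ⟨x, 0, z⟩ = u ⟨x - 1, 0, z⟩ := fun x z => by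
      rw [hu, step, a_inv_mul, b_inv_mul, hneg x (0 - 1) z (by norm_num)]
      simp
    have hconst' : ∀ x, u ⟨x, 0, 0⟩ = u ⟨0, 0, 0⟩ := fun x => by
      induction x with
      | zero => rfl
      | succ n ih => rw [hconst]; simpa using ih
      | pred n ih => rw [← hconst]; exact ih
    refine ⟨u ⟨0, 0, 0⟩, ?_⟩
    set t := u ⟨0, 0, 0⟩
    have := eq_zero_of_abs_le_h₀ (d := fun g => u g - t * h₀ g) (C := 1 + |t|)
      (fun g => by rw [hu g, h₀_eq_step g]; simp only [step]; ring)
      (fun g => by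
        have h1 : 0 ≤ h₀ g := Nat.cast_nonneg _
        calc |u g - t * h₀ g| ≤ |u g| + |t * h₀ g| := abs_sub _ _
          _ = u g + |t| * h₀ g := by rw [abs_of_nonneg (hu0 g), abs_mul, abs_of_nonneg h1]
          _ ≤ _ := by linarith [huh g])
      (fun x z => by
        by_cases hz : z = 0
        · subst hz
          simp [h₀, partitionCount_zero, hconst', t]
        · have := huh ⟨x, 0, z⟩
          simp only [h₀, partitionCount_zero, if_neg hz, Nat.cast_zero, mul_zero,
            sub_zero] at this ⊢
          exact le_antisymm this (hu0 _))
    exact fun g => sub_eq_zero.1 (congrFun this g)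

theorem isMinimal_h₁ : IsMinimal h₁ := h₀_comp_swap ▸ isMinimal_h₀.comp_swap

/-! ### Bounded harmonic functions are constant -/

theorem central_mul_mul (g g' : Heisenberg) : g * (c * g') = c * (g * g') := by
  rw [← mul_assoc, mul_c_comm, mul_assoc]

theorem ba_inv_eq (g : Heisenberg) : a⁻¹ * (b⁻¹ * g) = c * (b⁻¹ * (a⁻¹ * g)) := by
  obtain ⟨x, y, z⟩ := g
  simp only [a_inv_mul, b_inv_mul, c_mul]
  ext <;> simp; ring

section Bounded

variable {p q : ℝ}

/-- If `u ≤ M` is harmonic for a random walk and `u` is `ε`-close to `M` at `g`, it is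
`ε / κⁿ`-close at the points reached from `g` in `n` steps. -/
theorem near_sup_of_step (hp : 0 < p) (hq : 0 < q) (hpq : p + q = 1) {u : Heisenberg → ℝ}
    (hu : ∀ g, u g = p * u (a⁻¹ * g) + q * u (b⁻¹ * g)) {M : ℝ} (hM : ∀ g, u g ≤ M)
    (g : Heisenberg) :
    min p q * (M - u (a⁻¹ * g)) ≤ M - u g ∧ min p q * (M - u (b⁻¹ * g)) ≤ M - u g := by
  have h1 : M - u g = p * (M - u (a⁻¹ * g)) + q * (M - u (b⁻¹ * g)) := by
    rw [hu g]; linear_combination -M * hpq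
  have h2 : 0 ≤ M - u (a⁻¹ * g) := sub_nonneg.2 (hM _)
  have h3 : 0 ≤ M - u (b⁻¹ * g) := sub_nonneg.2 (hM _)
  rw [h1]
  constructor
  · have := mul_le_mul_of_nonneg_right (min_le_left p q) h2
    have := mul_nonneg hq.le h3
    linarith
  · have := mul_le_mul_of_nonneg_right (min_le_right p q) h3
    have := mul_nonneg hp.le h2
    linarith

/-- If the points `tᵏ v g`, `k < N`, are reached from `g` in a bounded number of steps, a bounded
function `f` whose increments along `t` are harmonic has nonpositive increments. -/
theorem increment_nonpos {κ : ℝ} (hκ : 0 < κ) {f : Heisenberg → ℝ} {C : ℝ}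
    (hf : ∀ g, |f g| ≤ C) (t : Heisenberg)
    (hreach : ∀ N : ℕ, ∃ (n : ℕ) (v : Heisenberg), ∀ k < N, ∀ g (M : ℝ),
      (∀ g, f (t * g) - f g ≤ M) →
      κ ^ n * (M - (f (t * (t ^ k * (v * g))) - f (t ^ k * (v * g)))) ≤ M - (f (t * g) - f g))
    (g : Heisenberg) : f (t * g) - f g ≤ 0 := by
  set u : Heisenberg → ℝ := fun g => f (t * g) - f g with hudef
  have hbdd : BddAbove (Set.range u) := ⟨2 * C, by
    rintro _ ⟨g, rfl⟩
    have h1 := abs_le.1 (hf (t * g))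
    have h2 := abs_le.1 (hf g)
    simp only [hudef]; linarith⟩
  set M := ⨆ g, u g
  have hM : ∀ g, u g ≤ M := le_ciSup hbdd
  suffices M ≤ 0 from (hM g).trans this
  by_contra! hMpos
  -- `N` increments, each at least `M / 2`, add up to more than `2 * C`, the largest possible
  -- variation of `f`.
  obtain ⟨N, hN⟩ := exists_nat_gt (4 * C / M)
  rw [div_lt_iff₀ hMpos] at hN
  obtain ⟨n, v, hv⟩ := hreach N
  have hκn : 0 < κ ^ n := pow_pos hκ n
  obtain ⟨g₁, hg₁⟩ := exists_lt_of_lt_ciSup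
    (show M - κ ^ n * (M / 2) < ⨆ g, u g from sub_lt_self _ (by positivity))
  have hk : ∀ k < N, M / 2 ≤ u (t ^ k * (v * g₁)) := fun k hk => by
    have h1 := hv k hk g₁ M hM
    have h2 : κ ^ n * (M - u (t ^ k * (v * g₁))) < κ ^ n * (M / 2) := by
      refine lt_of_le_of_lt h1 ?_
      change M - u g₁ < _
      linarith
    have := lt_of_mul_lt_mul_left h2 hκn.le
    linarith
  have hsum : ∀ m ≤ N, m * (M / 2) ≤ f (t ^ m * (v * g₁)) - f (v * g₁) := by
    intro m
    induction m with
    | zero => simp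
    | succ m ih =>
      intro hm
      have h1 := ih (by omega)
      have h2 := hk m (by omega)
      simp only [hudef] at h2
      rw [← mul_assoc, ← pow_succ'] at h2
      push_cast
      linarith
  have h1 := hsum N le_rfl
  have h2 := abs_le.1 (hf (t ^ N * (v * g₁)))
  have h3 := abs_le.1 (hf (v * g₁))
  linarith

variable {f : Heisenberg → ℝ} {C : ℝ}

theorem near_sup_pow (hp : 0 < p) (hq : 0 < q) (hpq : p + q = 1) {u : Heisenberg → ℝ}
    (hu : ∀ g, u g = p * u (a⁻¹ * g) + q * u (b⁻¹ * g)) {M : ℝ} (hM : ∀ g, u g ≤ M)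
    (w : List Bool) (g : Heisenberg) :
    min p q ^ w.length * (M - u ((w.map fun i => cond i a⁻¹ b⁻¹).prod * g)) ≤ M - u g := by
  have hκ : 0 ≤ min p q := (lt_min hp hq).le
  induction w with
  | nil => simp
  | cons i w ih =>
    refine le_trans ?_ ih
    have h1 := near_sup_of_step hp hq hpq hu hM ((w.map fun i => cond i a⁻¹ b⁻¹).prod * g)
    rw [List.length_cons, pow_succ, mul_assoc]
    refine mul_le_mul_of_nonneg_left ?_ (pow_nonneg hκ _)
    rw [List.map_cons, List.prod_cons, mul_assoc]
    cases i
    · exact h1.2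
    · exact h1.1

/-- Since `c` is central, increments along `c` are harmonic. The words `(a⁻¹ b⁻¹)ᵏ (b⁻¹ a⁻¹)ᴺ⁻ᵏ` all
have length `2 * N` and equal `cᵏ (b⁻¹ a⁻¹)ᴺ`, so all the required points are reached in the same
number of steps. -/
theorem central_increment_nonpos (hp : 0 < p) (hq : 0 < q) (hpq : p + q = 1)
    (hf : ∀ g, f g = p * f (a⁻¹ * g) + q * f (b⁻¹ * g)) (hC : ∀ g, |f g| ≤ C)
    (g : Heisenberg) : f (c * g) - f g ≤ 0 := by
  refine increment_nonpos (lt_min hp hq) hC c (fun N => ?_) g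
  refine ⟨2 * N, (b⁻¹ * a⁻¹) ^ N, fun k hk g M hM => ?_⟩
  have hu : ∀ g, f (c * g) - f g = p * (f (c * (a⁻¹ * g)) - f (a⁻¹ * g)) +
      q * (f (c * (b⁻¹ * g)) - f (b⁻¹ * g)) := fun g => by
    rw [hf (c * g), hf g, central_mul_mul, central_mul_mul]; ring
  have hcomm : a⁻¹ * b⁻¹ = c * (b⁻¹ * a⁻¹) := by simpa using ba_inv_eq 1
  have hword : c ^ k * ((b⁻¹ * a⁻¹) ^ N * g) = (a⁻¹ * b⁻¹) ^ k * (b⁻¹ * a⁻¹) ^ (N - k) * g := by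
    have hc : Commute c (b⁻¹ * a⁻¹) := (mul_c_comm _).symm
    rw [hcomm, hc.mul_pow, mul_assoc (c ^ k), ← pow_add, Nat.add_sub_cancel' hk.le, mul_assoc]
  have := near_sup_pow hp hq hpq hu hM
    ((List.replicate k [true, false]).flatten ++ (List.replicate (N - k) [false, true]).flatten) g
  have hlen : ((List.replicate k [true, false]).flatten ++
      (List.replicate (N - k) [false, true]).flatten).length = 2 * N := by
    simp; omega
  have hprod : (((List.replicate k [true, false]).flatten ++
      (List.replicate (N - k) [false, true]).flatten).map fun i => cond i a⁻¹ b⁻¹).prod =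
      (a⁻¹ * b⁻¹) ^ k * (b⁻¹ * a⁻¹) ^ (N - k) := by
    simp [List.map_flatten, List.prod_flatten]
  rw [hlen, hprod] at this
  rw [hword]
  exact this

theorem apply_c_mul_of_bounded (hp : 0 < p) (hq : 0 < q) (hpq : p + q = 1)
    (hf : ∀ g, f g = p * f (a⁻¹ * g) + q * f (b⁻¹ * g)) (hC : ∀ g, |f g| ≤ C)
    (g : Heisenberg) : f (c * g) = f g := by
  have h1 := central_increment_nonpos hp hq hpq hf hC g
  have h2 := central_increment_nonpos (f := fun g => -f g) hp hq hpq
    (fun g => by rw [hf g]; ring) (fun g => by simpa using hC g) g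
  linarith

/-- Invariance under `c` lets `a⁻¹` and `b⁻¹` be exchanged inside `f`, so increments along `a⁻¹` are
harmonic as well. -/
theorem a_increment_nonpos (hp : 0 < p) (hq : 0 < q) (hpq : p + q = 1)
    (hf : ∀ g, f g = p * f (a⁻¹ * g) + q * f (b⁻¹ * g)) (hC : ∀ g, |f g| ≤ C)
    (g : Heisenberg) : f (a⁻¹ * g) - f g ≤ 0 := by
  have hc := apply_c_mul_of_bounded hp hq hpq hf hC
  have hu : ∀ g, f (a⁻¹ * g) - f g = p * (f (a⁻¹ * (a⁻¹ * g)) - f (a⁻¹ * g)) +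
      q * (f (a⁻¹ * (b⁻¹ * g)) - f (b⁻¹ * g)) := fun g => by
    rw [ba_inv_eq, hc]; linear_combination hf (a⁻¹ * g) - hf g
  have hκ := lt_min hp hq
  refine increment_nonpos hκ hC a⁻¹ (fun N => ⟨N, 1, fun k hk g M hM => ?_⟩) g
  have := near_sup_pow hp hq hpq hu hM (List.replicate k true) g
  simp only [List.length_replicate, List.map_replicate, List.prod_replicate, cond_true] at this
  rw [one_mul]
  -- The words have different lengths `k < N`; as `min p q ≤ 1`, the exponent can be raised to the
  -- common value `N`.
  refine le_trans (mul_le_mul_of_nonneg_right ?_ (sub_nonneg.2 (hM _))) this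
  exact pow_le_pow_of_le_one hκ.le (by linarith [min_le_left p q]) hk.le

theorem apply_a_inv_mul_of_bounded (hp : 0 < p) (hq : 0 < q) (hpq : p + q = 1)
    (hf : ∀ g, f g = p * f (a⁻¹ * g) + q * f (b⁻¹ * g)) (hC : ∀ g, |f g| ≤ C)
    (g : Heisenberg) : f (a⁻¹ * g) = f g := by
  have h1 := a_increment_nonpos hp hq hpq hf hC g
  have h2 := a_increment_nonpos (f := fun g => -f g) hp hq hpq
    (fun g => by rw [hf g]; ring) (fun g => by simpa using hC g) g
  linarith

end Bounded

/-- A function that is multiplied by constants under the generators is a character. -/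
theorem eq_mul_character {f : Heisenberg → ℝ} {r s : ℝ} (hr : r ≠ 0) (hs : s ≠ 0)
    (hc : ∀ g, f (c * g) = f g) (ha : ∀ g, f (a⁻¹ * g) = r⁻¹ * f g)
    (hb : ∀ g, f (b⁻¹ * g) = s⁻¹ * f g) (g : Heisenberg) : f g = f 1 * character r s g := by
  have hz : ∀ x y z : ℤ, f ⟨x, y, z⟩ = f ⟨x, y, 0⟩ := fun x y z => by
    induction z with
    | zero => rfl
    | succ n ih => rw [← ih, ← hc ⟨x, y, n⟩, c_mul]
    | pred n ih => rw [← ih, ← hc, c_mul]; simp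
  have hx : ∀ x y : ℤ, f ⟨x, y, 0⟩ = r ^ x * f ⟨0, y, 0⟩ := fun x y => by
    have h1 : ∀ x : ℤ, f ⟨x - 1, y, 0⟩ = r⁻¹ * f ⟨x, y, 0⟩ := fun x => by
      rw [← ha, a_inv_mul, hz (x - 1) y (0 - y)]
    induction x with
    | zero => simp
    | succ n ih =>
      have := h1 (n + 1)
      rw [add_sub_cancel_right, ih] at this
      rw [zpow_add_one₀ hr]
      field_simp at this ⊢
      linarith
    | pred n ih => rw [h1, ih, zpow_sub_one₀ hr]; ring
  have hy : ∀ y : ℤ, f ⟨0, y, 0⟩ = s ^ y * f ⟨0, 0, 0⟩ := fun y => by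
    have h1 : ∀ y : ℤ, f ⟨0, y - 1, 0⟩ = s⁻¹ * f ⟨0, y, 0⟩ := fun y => by
      rw [← hb, b_inv_mul]
    induction y with
    | zero => simp
    | succ n ih =>
      have := h1 (n + 1)
      rw [add_sub_cancel_right, ih] at this
      rw [zpow_add_one₀ hs]
      field_simp at this ⊢
      linarith
    | pred n ih => rw [h1, ih, zpow_sub_one₀ hs]; ring
  obtain ⟨x, y, z⟩ := g
  rw [hz, hx, hy, character]
  change _ = f ⟨0, 0, 0⟩ * _
  ring

/-- Doob transform: `u / character r s` is bounded and harmonic for the walk with probabilities `1 /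
r`, `1 / s`, hence constant. -/
theorem isMinimal_character {r s : ℝ} (hr : 0 < r) (hs : 0 < s) (hrs : 1 / r + 1 / s = 1) :
    IsMinimal (character r s) := by
  have hpos : ∀ g, 0 < character r s g := fun g => mul_pos (zpow_pos hr _) (zpow_pos hs _)
  have ha : ∀ g, character r s (a⁻¹ * g) = r⁻¹ * character r s g := fun g => by
    obtain ⟨x, y, z⟩ := g
    simp only [a_inv_mul, character, zpow_sub_one₀ hr.ne']; ring
  have hb : ∀ g, character r s (b⁻¹ * g) = s⁻¹ * character r s g := fun g => by
    obtain ⟨x, y, z⟩ := g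
    simp only [b_inv_mul, character, zpow_sub_one₀ hs.ne']; ring
  have hc : ∀ g, character r s (c * g) = character r s g := fun g => by
    obtain ⟨x, y, z⟩ := g
    simp only [c_mul, character]
  have hrs' : r⁻¹ + s⁻¹ = 1 := by simpa using hrs
  refine ⟨⟨fun g => (hpos g).le, fun h => ?_, fun g => ?_⟩, fun u hu0 huh hu => ?_⟩
  · exact (hpos 1).ne' (congrFun h 1)
  · rw [step, ha, hb, ← add_mul, hrs', one_mul]
  · set f : Heisenberg → ℝ := fun g => u g / character r s g with hfdef
    have huf : ∀ g, u g = f g * character r s g := fun g => by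
      simp only [hfdef]; field_simp [(hpos g).ne']
    have hf : ∀ g, f g = r⁻¹ * f (a⁻¹ * g) + s⁻¹ * f (b⁻¹ * g) := fun g => by
      have h1 := hu g
      rw [step, huf, huf (a⁻¹ * g), huf (b⁻¹ * g), ha, hb] at h1
      exact mul_right_cancel₀ (hpos g).ne' (by linarith)
    have hC : ∀ g, |f g| ≤ 1 := fun g => by
      rw [abs_of_nonneg (div_nonneg (hu0 g) (hpos g).le)]
      exact (div_le_one (hpos g)).2 (huh g)
    have hr' := inv_pos.2 hr
    have hs' := inv_pos.2 hs
    have hfc := apply_c_mul_of_bounded hr' hs' hrs' hf hC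
    have hfa := apply_a_inv_mul_of_bounded hr' hs' hrs' hf hC
    have hfb : ∀ g, f (b⁻¹ * g) = f g := fun g => by
      have h1 := hf g
      rw [hfa] at h1
      refine mul_left_cancel₀ hs'.ne' ?_
      linear_combination (-1 : ℝ) * h1 - f g * hrs'
    refine ⟨u 1 / character r s 1, fun g => ?_⟩
    have h1 := eq_mul_character one_ne_zero one_ne_zero hfc (fun g => by simpa using hfa g)
      (fun g => by simpa using hfb g) g
    rw [huf g, h1]
    simp [character, hfdef]

/-! ### Harmonic functions charging a path that is eventually constant -/

theorem step_mono {f k : Heisenberg → ℝ} (h : ∀ g, f g ≤ k g) (g : Heisenberg) :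
    step f g ≤ step k g := add_le_add (h _) (h _)

theorem a_inv_pow_mul (n : ℕ) (x y z : ℤ) :
    a⁻¹ ^ n * ⟨x, y, z⟩ = (⟨x - n, y, z - n * y⟩ : Heisenberg) := by
  induction n with
  | zero => simp
  | succ n ih => rw [pow_succ', mul_assoc, ih, a_inv_mul]; ext <;> simp <;> ring

/-- Along `y = z = 0` the function `h` increases with `x`, so the bound on the negative half-line
holds on the whole line. It then propagates by the same double induction on `y` and `z` as in the
uniqueness lemma, since `h₀` obeys the same recurrence and vanishes for `z < 0`. -/
theorem mul_h₀_le {h : Heisenberg → ℝ} (h0 : ∀ g, 0 ≤ h g) (hh : ∀ g, h g = step h g) {L : ℝ}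
    (hL : ∀ n : ℕ, L ≤ h (a⁻¹ ^ n)) (g : Heisenberg) : L * h₀ g ≤ h g := by
  have hx : ∀ x : ℤ, L ≤ h ⟨x, 0, 0⟩ := by
    have hmono : ∀ x : ℤ, h ⟨x - 1, 0, 0⟩ ≤ h ⟨x, 0, 0⟩ := fun x => by
      rw [hh ⟨x, 0, 0⟩, step, a_inv_mul, sub_zero]
      exact le_add_of_nonneg_right (h0 _)
    intro x
    induction x with
    | zero => exact hL 0
    | succ n ih =>
      refine ih.trans ?_
      have := hmono (n + 1)
      simpa using this
    | pred n _ =>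
      have h1 := hL (n + 1)
      have h2 := a_inv_pow_mul (n + 1) 0 0 0
      rw [show (⟨0, 0, 0⟩ : Heisenberg) = 1 from rfl, mul_one] at h2
      rw [h2] at h1
      convert h1 using 2
      ext <;> simp
      ring
  have hneg : ∀ x y z, y < 0 ∨ z < 0 → L * h₀ ⟨x, y, z⟩ ≤ h ⟨x, y, z⟩ := fun x y z hy => by
    have : partitionCount y z = 0 := hy.elim partitionCount_of_neg partitionCount_of_neg_right
    simp only [h₀, this, Nat.cast_zero, mul_zero]
    exact h0 _
  have key : ∀ (k : ℕ) (x z : ℤ), L * h₀ ⟨x, k, z⟩ ≤ h ⟨x, k, z⟩ := by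
    intro k
    induction k with
    | zero =>
      intro x z
      simp only [h₀, Nat.cast_zero, partitionCount_zero]
      split_ifs with hz
      · subst hz; simpa using hx x
      · simpa using h0 _
    | succ k ih =>
      have aux : ∀ (n : ℕ) (x z : ℤ), z < n →
          L * h₀ ⟨x, (k + 1 : ℕ), z⟩ ≤ h ⟨x, (k + 1 : ℕ), z⟩ := by
        intro n
        induction n with
        | zero => intro x z hz; exact hneg _ _ _ (Or.inr (by simpa using hz))
        | succ n ihn =>
          intro x z hz
          rw [hh, h₀_eq_step, step, step, a_inv_mul, b_inv_mul, mul_add]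
          refine add_le_add (ihn _ _ (by push_cast at hz ⊢; omega)) ?_
          have := ih x z
          push_cast
          simpa using this
      intro x z
      exact aux (z.toNat + 1) x z (by omega)
  obtain ⟨x, y, z⟩ := g
  rcases lt_or_ge y 0 with hy | hy
  · exact hneg x y z (Or.inl hy)
  · obtain ⟨k, rfl⟩ := Int.eq_ofNat_of_zero_le hy
    exact key k x z

theorem IsMinimal.proportional_of_le {h k : Heisenberg → ℝ} (hh : IsMinimal h)
    (hk0 : ∀ g, 0 ≤ k g) (hk1 : k ≠ 0) (hk : ∀ g, k g = step k g) {L : ℝ} (hL : 0 < L)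
    (hle : ∀ g, L * k g ≤ h g) : Proportional h k := by
  obtain ⟨θ, hθ⟩ := hh.2 (fun g => L * k g) (fun g => mul_nonneg hL.le (hk0 g)) hle
    (fun g => by rw [hk g]; simp only [step]; ring)
  obtain ⟨g, hg⟩ := Function.ne_iff.1 hk1
  have hkg : 0 < k g := lt_of_le_of_ne (hk0 g) (Ne.symm hg)
  have h1 : 0 < θ * h g := by rw [← hθ]; positivity
  have h2 : 0 < θ := by
    by_contra! h2
    exact absurd h1 (not_lt.2 (mul_nonpos_of_nonpos_of_nonneg h2 (hh.1.1 g)))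
  refine ⟨L / θ, by positivity, fun g => ?_⟩
  have := hθ g
  field_simp
  linarith

theorem IsMinimal.proportional_h₀ {h : Heisenberg → ℝ} (hh : IsMinimal h) {g₁ : Heisenberg}
    {L : ℝ} (hL : 0 < L) (hLe : ∀ n : ℕ, L ≤ h (a⁻¹ ^ n * g₁)) :
    Proportional h (h₀ ∘ rightTranslation g₁⁻¹) := by
  have hm := isMinimal_h₀.comp_rightTranslation g₁⁻¹
  refine hh.proportional_of_le hm.1.1 hm.1.2.1 hm.1.2.2 hL fun g => ?_
  have hm' := (hh.comp_rightTranslation g₁).1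
  have := mul_h₀_le hm'.1 hm'.2.2 hLe (g * g₁⁻¹)
  simpa [rightTranslation] using this

theorem antitone_a_inv_pow {h : Heisenberg → ℝ} (h0 : ∀ g, 0 ≤ h g) (hh : ∀ g, h g = step h g)
    (g : Heisenberg) : Antitone fun n : ℕ => h (a⁻¹ ^ n * g) := by
  refine antitone_nat_of_succ_le fun n => ?_
  rw [hh (a⁻¹ ^ n * g), step, pow_succ', mul_assoc]
  exact le_add_of_nonneg_right (h0 _)

/-- A minimal function either is a translate of `h₀` or gives no mass to the paths ending with
`a⁻¹, a⁻¹, …`. -/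
theorem IsMinimal.proportional_h₀_or_tendsto {h : Heisenberg → ℝ} (hh : IsMinimal h) :
    (∃ g₀, Proportional h (h₀ ∘ rightTranslation g₀)) ∨
      ∀ g, Tendsto (fun n : ℕ => h (a⁻¹ ^ n * g)) atTop (𝓝 0) := by
  by_cases H : ∃ g₁ L, 0 < L ∧ ∀ n : ℕ, L ≤ h (a⁻¹ ^ n * g₁)
  · obtain ⟨g₁, L, hL, hLe⟩ := H
    exact Or.inl ⟨_, hh.proportional_h₀ hL hLe⟩
  · right
    intro g
    have hanti := antitone_a_inv_pow hh.1.1 hh.1.2.2 g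
    have hbdd : BddBelow (Set.range fun n : ℕ => h (a⁻¹ ^ n * g)) :=
      ⟨0, by rintro _ ⟨n, rfl⟩; exact hh.1.1 _⟩
    have hlim := tendsto_atTop_ciInf hanti hbdd
    have h1 : 0 ≤ ⨅ n : ℕ, h (a⁻¹ ^ n * g) := le_ciInf fun n => hh.1.1 _
    rcases h1.eq_or_lt with h1 | h1
    · rwa [← h1] at hlim
    · exact absurd ⟨g, _, h1, fun n => ciInf_le hbdd n⟩ H

theorem swap_a_inv_pow_mul (n : ℕ) (g : Heisenberg) :
    swap (a⁻¹ ^ n * g) = b⁻¹ ^ n * swap g := by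
  induction n with
  | zero => simp
  | succ n ih => rw [pow_succ', mul_assoc, swap_mul, ih, swap_a_inv, pow_succ', mul_assoc]

theorem Proportional.comp {h k : Heisenberg → ℝ} (H : Proportional h k)
    (e : Heisenberg → Heisenberg) : Proportional (h ∘ e) (k ∘ e) :=
  H.imp fun _ hr => ⟨hr.1, fun g => hr.2 (e g)⟩

theorem IsMinimal.proportional_h₁_or_tendsto {h : Heisenberg → ℝ} (hh : IsMinimal h) :
    (∃ g₀, Proportional h (h₁ ∘ rightTranslation g₀)) ∨
      ∀ g, Tendsto (fun n : ℕ => h (b⁻¹ ^ n * g)) atTop (𝓝 0) := by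
  refine hh.comp_swap.proportional_h₀_or_tendsto.imp ?_ ?_
  · rintro ⟨g₀, H⟩
    refine ⟨swap g₀, ?_⟩
    have := H.comp swap
    rwa [comp_swap_comp_swap, comp_rightTranslation_comp_swap, h₀_comp_swap] at this
  · intro H g
    have := H (swap g)
    simpa only [Function.comp, swap_a_inv_pow_mul, swap_swap] using this

/-! ### The central element acts by a scalar -/

/-- The walk restricted to the pairs of steps `aa` and `bb`. -/
def pairStep (f : Heisenberg → ℝ) (g : Heisenberg) : ℝ :=
  f (a⁻¹ * (a⁻¹ * g)) + f (b⁻¹ * (b⁻¹ * g))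

theorem pairStep_mono {f k : Heisenberg → ℝ} (h : ∀ g, f g ≤ k g) (g : Heisenberg) :
    pairStep f g ≤ pairStep k g := add_le_add (h _) (h _)

/-- The two mixed pairs lead to points that differ by `c`; the last term is the pair `a⁻¹` then
`b⁻¹`, rewritten as the other mixed pair started from `c⁻¹ * g`. -/
theorem step_step (f : Heisenberg → ℝ) (g : Heisenberg) :
    step (step f) g = pairStep f g + f (a⁻¹ * (b⁻¹ * g)) + f (a⁻¹ * (b⁻¹ * (c⁻¹ * g))) := by
  rw [ba_inv_eq (c⁻¹ * g), ← central_mul_mul, ← central_mul_mul, mul_inv_cancel_left]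
  simp only [step, pairStep]
  ring

theorem pairStep_le_step_step {f : Heisenberg → ℝ} (hf : ∀ g, 0 ≤ f g) (g : Heisenberg) :
    pairStep f g ≤ step (step f) g := by
  rw [step_step]
  linarith [hf (a⁻¹ * (b⁻¹ * g)), hf (a⁻¹ * (b⁻¹ * (c⁻¹ * g)))]

theorem exists_tendsto_of_monotone {F : ℕ → Heisenberg → ℝ} {h : Heisenberg → ℝ}
    (hF : ∀ n g, F n g ≤ F (n + 1) g) (hle : ∀ n g, F n g ≤ h g) :
    ∃ F' : Heisenberg → ℝ, (∀ g, Tendsto (fun n => F n g) atTop (𝓝 (F' g))) ∧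
      ∀ n g, F n g ≤ F' g := by
  have hmono : ∀ g, Monotone fun n => F n g := fun g => monotone_nat_of_le_succ fun n => hF n g
  have hbdd : ∀ g, BddAbove (Set.range fun n => F n g) :=
    fun g => ⟨h g, by rintro _ ⟨n, rfl⟩; exact hle n g⟩
  exact ⟨fun g => ⨆ n, F n g, fun g => tendsto_atTop_ciSup (hmono g) (hbdd g),
    fun n g => le_ciSup (hbdd g) n⟩

theorem tendsto_step {F : ℕ → Heisenberg → ℝ} {F' : Heisenberg → ℝ}
    (h : ∀ g, Tendsto (fun n => F n g) atTop (𝓝 (F' g))) (g : Heisenberg) :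
    Tendsto (fun n => step (F n) g) atTop (𝓝 (step F' g)) := (h _).add (h _)

theorem tendsto_pairStep {F : ℕ → Heisenberg → ℝ} {F' : Heisenberg → ℝ}
    (h : ∀ g, Tendsto (fun n => F n g) atTop (𝓝 (F' g))) (g : Heisenberg) :
    Tendsto (fun n => pairStep (F n) g) atTop (𝓝 (pairStep F' g)) := (h _).add (h _)

theorem even_a_inv_mul (e : ℤ) (g : Heisenberg) :
    Even ((a⁻¹ * g).x + (a⁻¹ * g).y + e) ↔ ¬ Even (g.x + g.y + e) := by
  obtain ⟨x, y, z⟩ := g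
  rw [a_inv_mul, ← Int.even_sub_one]
  ring_nf

theorem even_b_inv_mul (e : ℤ) (g : Heisenberg) :
    Even ((b⁻¹ * g).x + (b⁻¹ * g).y + e) ↔ ¬ Even (g.x + g.y + e) := by
  obtain ⟨x, y, z⟩ := g
  rw [b_inv_mul, ← Int.even_sub_one]
  ring_nf

/-- On a parity class of `x + y`, minimality also holds with respect to the square of the
Markov operator. -/
theorem IsMinimal.exists_eq_mul_of_even {h : Heisenberg → ℝ} (hh : IsMinimal h) (e : ℤ)
    {u : Heisenberg → ℝ} (hu0 : ∀ g, 0 ≤ u g) (huh : ∀ g, u g ≤ h g)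
    (hu : ∀ g, Even (g.x + g.y + e) → u g = step (step u) g) :
    ∃ θ : ℝ, ∀ g, Even (g.x + g.y + e) → u g = θ * h g := by
  classical
  -- Each step changes the parity of `x + y`, so extending `u` from its class by one step gives a
  -- function harmonic everywhere.
  set v : Heisenberg → ℝ := fun g => if Even (g.x + g.y + e) then u g else step u g with hv
  have hv1 : ∀ g, Even (g.x + g.y + e) → v g = u g := fun g hg => if_pos hg
  have hv2 : ∀ g, ¬ Even (g.x + g.y + e) → v g = step u g := fun g hg => if_neg hg
  obtain ⟨θ, hθ⟩ := hh.2 v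
    (fun g => by
      simp only [hv]; split_ifs
      exacts [hu0 g, add_nonneg (hu0 _) (hu0 _)])
    (fun g => by
      simp only [hv]; split_ifs
      exacts [huh g, (step_mono huh g).trans_eq (hh.1.2.2 g).symm])
    (fun g => by
      by_cases hg : Even (g.x + g.y + e)
      · rw [hv1 g hg, hu g hg]
        change _ = v (a⁻¹ * g) + v (b⁻¹ * g)
        rw [hv2, hv2, step]
        · rwa [even_b_inv_mul, not_not]
        · rwa [even_a_inv_mul, not_not]
      · rw [hv2 g hg, step, step, hv1, hv1]
        · rwa [even_b_inv_mul]
        · rwa [even_a_inv_mul])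
  exact ⟨θ, fun g hg => by rw [← hv1 g hg, hθ]⟩

theorem even_pairStep {e : ℤ} {f k : Heisenberg → ℝ}
    (hfk : ∀ g, Even (g.x + g.y + e) → f g = k g) :
    ∀ g, Even (g.x + g.y + e) → pairStep f g = pairStep k g := fun g hg => by
  rw [pairStep, pairStep, hfk, hfk]
  · rwa [even_b_inv_mul, even_b_inv_mul, not_not]
  · rwa [even_a_inv_mul, even_a_inv_mul, not_not]

theorem pairStep_iterate_mono {f k : Heisenberg → ℝ} (h : ∀ g, f g ≤ k g) (n : ℕ) :
    ∀ g, pairStep^[n] f g ≤ pairStep^[n] k g := by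
  induction n with
  | zero => exact h
  | succ n ih =>
    intro g
    rw [Function.iterate_succ_apply', Function.iterate_succ_apply']
    exact pairStep_mono ih g

theorem even_pairStep_iterate {e : ℤ} {f h : Heisenberg → ℝ} {t : ℝ}
    (hfk : ∀ g, Even (g.x + g.y + e) → f g = t * h g) (n : ℕ) :
    ∀ g, Even (g.x + g.y + e) → pairStep^[n] f g = t * pairStep^[n] h g := by
  induction n with
  | zero => exact hfk
  | succ n ih =>
    intro g hg
    rw [Function.iterate_succ_apply', Function.iterate_succ_apply']
    rw [even_pairStep (k := fun g => t * pairStep^[n] h g) ih g hg]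
    simp only [pairStep]; ring

section PairStep

variable {h : Heisenberg → ℝ}

theorem pairStep_iterate_nonneg (h0 : ∀ g, 0 ≤ h g) (n : ℕ) (g : Heisenberg) :
    0 ≤ pairStep^[n] h g := by
  induction n generalizing g with
  | zero => exact h0 g
  | succ n ih => rw [Function.iterate_succ_apply']; exact add_nonneg (ih _) (ih _)

theorem pairStep_iterate_succ_le (h0 : ∀ g, 0 ≤ h g) (hh : ∀ g, h g = step h g) (n : ℕ)
    (g : Heisenberg) : pairStep^[n + 1] h g ≤ pairStep^[n] h g := by
  rw [Function.iterate_succ_apply]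
  refine pairStep_iterate_mono (fun g => ?_) n g
  refine (pairStep_le_step_step h0 g).trans_eq ?_
  rw [← funext hh, ← hh]

theorem pairStep_iterate_le (h0 : ∀ g, 0 ≤ h g) (hh : ∀ g, h g = step h g) (n : ℕ)
    (g : Heisenberg) : pairStep^[n] h g ≤ h g := by
  induction n with
  | zero => exact le_rfl
  | succ n ih => exact (pairStep_iterate_succ_le h0 hh n g).trans ih

/-- The paths all of whose pairs of steps, whichever the parity, are `aa` or `bb` are constant;
this is the part that starts with `a`. -/
theorem pairStep_add_le_a (h0 : ∀ g, 0 ≤ h g) (hh : ∀ g, h g = step h g) (n : ℕ) :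
    ∀ g, pairStep^[n] h g + pairStep^[n] h (a⁻¹ * g) ≤ h g + h (a⁻¹ ^ (2 * n + 1) * g) := by
  -- Crude bound for the branches whose leading pair is `bb`; the induction hypothesis is needed
  -- only on the branch that continues with `aa`.
  have hb : ∀ n g, pairStep^[n] h (b⁻¹ * (b⁻¹ * g)) ≤ h (b⁻¹ * g) := fun n g => by
    refine (pairStep_iterate_le h0 hh n _).trans ?_
    rw [hh (b⁻¹ * g), step]
    exact le_add_of_nonneg_left (h0 _)
  induction n with
  | zero => intro g; simp
  | succ n ih =>
    intro g
    have h1 := ih (a⁻¹ * (a⁻¹ * g))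
    have h2 := hb n g
    have h3 := hb n (a⁻¹ * g)
    have h4 := hh g
    have h5 := hh (a⁻¹ * g)
    rw [Function.iterate_succ_apply']
    simp only [step, pairStep] at h4 h5 ⊢
    have h6 : a⁻¹ ^ (2 * n + 1) * (a⁻¹ * (a⁻¹ * g)) = a⁻¹ ^ (2 * (n + 1) + 1) * g := by
      rw [← mul_assoc, ← mul_assoc, ← pow_succ, ← pow_succ]; rfl
    rw [h6] at h1
    linarith

theorem pairStep_add_le_b (h0 : ∀ g, 0 ≤ h g) (hh : ∀ g, h g = step h g) (n : ℕ)
    (g : Heisenberg) :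
    pairStep^[n] h g + pairStep^[n] h (b⁻¹ * g) ≤ h g + h (b⁻¹ ^ (2 * n + 1) * g) := by
  have hs : ∀ (n : ℕ) (g : Heisenberg), pairStep^[n] (h ∘ swap) g = pairStep^[n] h (swap g) := by
    intro n
    induction n with
    | zero => intro g; rfl
    | succ n ih =>
      intro g
      rw [Function.iterate_succ_apply', Function.iterate_succ_apply']
      simp only [pairStep, ih, swap_mul, swap_a_inv, swap_b_inv]
      ring
  have := pairStep_add_le_a (h := h ∘ swap) (fun g => h0 _)
    (fun g => by rw [step_comp_swap]; exact hh _) n (swap g)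
  simp only [hs, Function.comp, swap_a_inv_pow_mul, swap_swap] at this
  simpa only [swap_mul, swap_a_inv, swap_swap] using this

/-- Inclusion–exclusion: the two terms on the left count paths with constant pairs starting at time
0 and at time 1. A path of both kinds repeats a single letter, which the error terms on the right
account for. -/
theorem pairStep_add_step_le (h0 : ∀ g, 0 ≤ h g) (hh : ∀ g, h g = step h g) (n : ℕ)
    (g : Heisenberg) :
    pairStep^[n + 1] h g + step (pairStep^[n + 1] h) g ≤
      h g + (h (a⁻¹ ^ (2 * n + 1) * (a⁻¹ * g)) + h (b⁻¹ ^ (2 * n + 1) * (b⁻¹ * g))) := by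
  have h1 := pairStep_add_le_a h0 hh n (a⁻¹ * g)
  have h2 := pairStep_add_le_b h0 hh n (b⁻¹ * g)
  have h3 := pairStep_iterate_succ_le h0 hh n (a⁻¹ * g)
  have h4 := pairStep_iterate_succ_le h0 hh n (b⁻¹ * g)
  have h5 := hh g
  simp only [step] at h5 ⊢
  rw [Function.iterate_succ_apply' pairStep n h] at h3 h4 ⊢
  change pairStep^[n] h (a⁻¹ * (a⁻¹ * g)) + pairStep^[n] h (b⁻¹ * (b⁻¹ * g)) + _ ≤ _
  linarith

end PairStep

/-- If a minimal function gives no mass to eventually constant paths, then for one of the two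
parities almost all paths from that class have a pair of steps `ab` or `ba`. -/
theorem IsMinimal.exists_parity {h : Heisenberg → ℝ} (hh : IsMinimal h)
    (hA : ∀ g, Tendsto (fun n : ℕ => h (a⁻¹ ^ n * g)) atTop (𝓝 0))
    (hB : ∀ g, Tendsto (fun n : ℕ => h (b⁻¹ ^ n * g)) atTop (𝓝 0)) :
    ∃ e : ℤ, ∀ g, Even (g.x + g.y + e) →
      Tendsto (fun n : ℕ => pairStep^[n] h g) atTop (𝓝 0) := by
  have h0 := hh.1.1
  have hst := hh.1.2.2
  -- The iterates decrease, hence the sign. Their limit `K` is the mass of the paths with all pairs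
  -- constant.
  obtain ⟨K', hK', -⟩ := exists_tendsto_of_monotone (F := fun n g => -pairStep^[n] h g)
    (h := fun _ => 0)
    (fun n g => neg_le_neg (pairStep_iterate_succ_le h0 hst n g))
    (fun n g => neg_nonpos.2 (pairStep_iterate_nonneg h0 n g))
  obtain ⟨K, hK⟩ : ∃ K : Heisenberg → ℝ,
      ∀ g, Tendsto (fun n : ℕ => pairStep^[n] h g) atTop (𝓝 (K g)) :=
    ⟨fun g => -K' g, fun g => by simpa using (hK' g).neg⟩
  have hK0 : ∀ g, 0 ≤ K g := fun g =>
    ge_of_tendsto' (hK g) fun n => pairStep_iterate_nonneg h0 n g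
  have hKA : pairStep K = K := funext fun g => by
    have h1 := (tendsto_add_atTop_iff_nat 1).2 (hK g)
    have h2 := tendsto_pairStep hK g
    simp only [Function.iterate_succ_apply'] at h1
    exact tendsto_nhds_unique h2 h1
  have hKsum : ∀ g, K g + step K g ≤ h g := fun g => by
    have h1 := fun g => (tendsto_add_atTop_iff_nat 1).2 (hK g)
    have hodd : Tendsto (fun n : ℕ => 2 * n + 1) atTop atTop :=
      tendsto_atTop_mono (fun n => show n ≤ 2 * n + 1 by omega) tendsto_id
    have h2 := (tendsto_const_nhds (x := h g)).add
      (((hA (a⁻¹ * g)).comp hodd).add ((hB (b⁻¹ * g)).comp hodd))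
    have := le_of_tendsto_of_tendsto' ((h1 g).add (tendsto_step h1 g)) h2
      fun n => pairStep_add_step_le h0 hst n g
    simpa using this
  -- `F n` is the mass of the paths whose pairs are constant after the first `n`. Its limit `H` is
  -- harmonic for two steps and keeps the inequality `H + step H ≤ h`.
  set F : ℕ → Heisenberg → ℝ := fun n => (fun f => step (step f))^[n] K with hF
  have hFsucc : ∀ n, F (n + 1) = step (step (F n)) := fun n => Function.iterate_succ_apply' _ n K
  have hFsum : ∀ n g, F n g + step (F n) g ≤ h g := by
    intro n
    induction n with
    | zero => exact hKsum
    | succ n ih =>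
      intro g
      have h1 := step_mono (step_mono ih) g
      rw [← funext hst, ← hst] at h1
      rw [hFsucc]
      refine le_trans (le_of_eq ?_) h1
      simp only [step]; ring
  have hF0 : ∀ n g, 0 ≤ F n g := by
    intro n
    induction n with
    | zero => exact hK0
    | succ n ih =>
      intro g
      rw [hFsucc]
      exact add_nonneg (add_nonneg (ih _) (ih _)) (add_nonneg (ih _) (ih _))
  have hFmono : ∀ n g, F n g ≤ F (n + 1) g := by
    intro n
    induction n with
    | zero =>
      intro g
      rw [hFsucc]
      exact (congrFun hKA g).symm.le.trans (pairStep_le_step_step hK0 g)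
    | succ n ih =>
      intro g
      rw [hFsucc, hFsucc (n + 1)]
      exact step_mono (step_mono ih) g
  have hFle : ∀ n g, F n g ≤ h g := fun n g =>
    le_trans (le_add_of_nonneg_right (add_nonneg (hF0 n _) (hF0 n _))) (hFsum n g)
  obtain ⟨H, hH, hFH⟩ := exists_tendsto_of_monotone hFmono hFle
  have hKH : ∀ g, K g ≤ H g := hFH 0
  have hHh : ∀ g, H g ≤ h g := fun g => le_of_tendsto' (hH g) fun n => hFle n g
  have hHst : ∀ g, H g = step (step H) g := fun g => by
    have h1 := (tendsto_add_atTop_iff_nat 1).2 (hH g)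
    have h2 := tendsto_step (fun g => tendsto_step hH g) g
    simp only [hFsucc] at h1
    exact tendsto_nhds_unique h1 h2
  have hHsum : ∀ g, H g + step H g ≤ h g := fun g =>
    le_of_tendsto' ((hH g).add (tendsto_step hH g)) fun n => hFsum n g
  by_contra! hcon
  have hge : ∀ e g, Even (g.x + g.y + e) → h g ≤ H g := by
    intro e
    obtain ⟨g₁, hg₁, hne⟩ := hcon e
    have hpos : 0 < K g₁ := by
      refine lt_of_le_of_ne (hK0 g₁) fun h1 => hne ?_
      rw [h1]; exact hK g₁
    obtain ⟨t, ht⟩ := hh.exists_eq_mul_of_even e (fun g => (hK0 g).trans (hKH g)) hHh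
      (fun g _ => hHst g)
    -- On the class `H = t * h`, while `K ≤ H` is fixed by `pairStep`. Letting `n` grow gives `K g₁
    -- ≤ t * K g₁`, so `t ≥ 1`.
    have h1 : ∀ n, K g₁ ≤ t * pairStep^[n] h g₁ := fun n => by
      rw [← even_pairStep_iterate ht n g₁ hg₁]
      have h2 := pairStep_iterate_mono hKH n g₁
      rwa [Function.iterate_fixed hKA] at h2
    have h2 : K g₁ ≤ t * K g₁ := ge_of_tendsto' ((hK g₁).const_mul t) h1
    have h3 : 1 ≤ t := by
      by_contra! h3
      nlinarith
    intro g hg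
    rw [ht g hg]
    exact le_mul_of_one_le_left (h0 g) h3
  -- If both parities fail, every `g` is covered: take `e = g.x + g.y`. Then `H + step H ≤ h`
  -- becomes `2 * h ≤ h`.
  have hge' : ∀ g, h g ≤ H g := fun g => hge (g.x + g.y) g (by simp [← two_mul])
  refine hh.1.2.1 (funext fun g => le_antisymm ?_ (h0 g))
  have h1 := hHsum g
  have h2 := step_mono hge' g
  rw [← hst] at h2
  change h g ≤ 0
  linarith [hge' g]

/-- Split the paths by the order of the letters in their first mixed pair. Exchanging these letters
matches one half, started at `g`, with the other half, started at `c⁻¹ * g`. -/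
theorem IsMinimal.exists_central_scalar {h : Heisenberg → ℝ} (hh : IsMinimal h)
    (hA : ∀ g, Tendsto (fun n : ℕ => h (a⁻¹ ^ n * g)) atTop (𝓝 0))
    (hB : ∀ g, Tendsto (fun n : ℕ => h (b⁻¹ ^ n * g)) atTop (𝓝 0)) :
    ∃ l : ℝ, 0 < l ∧ ∀ g, h (c * g) = l * h g := by
  have h0 := hh.1.1
  have hst := hh.1.2.2
  have hst2 : ∀ g, h g = step (step h) g := fun g => by rw [← funext hst, ← hst]
  obtain ⟨e, he⟩ := hh.exists_parity hA hB
  -- `F n g` is the mass of the paths whose first pair `ab` or `ba` is a `ba` among `n` pairs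
  set F : ℕ → Heisenberg → ℝ :=
    fun n => (fun f g => h (a⁻¹ * (b⁻¹ * g)) + pairStep f g)^[n] 0 with hF
  have hF_zero : F 0 = 0 := rfl
  have hFsucc : ∀ n g, F (n + 1) g = h (a⁻¹ * (b⁻¹ * g)) + pairStep (F n) g := fun n g => by
    simp only [hF, Function.iterate_succ_apply']
  have hFdec : ∀ n g, h g = pairStep^[n] h g + (F n g + F n (c⁻¹ * g)) := by
    intro n
    induction n with
    | zero => intro g; simp [hF_zero]
    | succ n ih =>
      intro g
      have h1 := hst2 g
      rw [step_step] at h1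
      rw [hFsucc, hFsucc, Function.iterate_succ_apply']
      have h2 := ih (a⁻¹ * (a⁻¹ * g))
      have h3 := ih (b⁻¹ * (b⁻¹ * g))
      have hc : ∀ s g : Heisenberg, s * (c⁻¹ * g) = c⁻¹ * (s * g) := fun s g => by
        rw [eq_inv_mul_iff_mul_eq, ← central_mul_mul, mul_inv_cancel_left]
      simp only [pairStep, hc] at h1 h2 h3 ⊢
      linarith
  have hF0 : ∀ n g, 0 ≤ F n g := by
    intro n
    induction n with
    | zero => intro g; exact le_rfl
    | succ n ih =>
      intro g
      rw [hFsucc]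
      exact add_nonneg (h0 _) (add_nonneg (ih _) (ih _))
  have hFmono : ∀ n g, F n g ≤ F (n + 1) g := by
    intro n
    induction n with
    | zero => intro g; exact hF0 1 g
    | succ n ih =>
      intro g
      rw [hFsucc, hFsucc (n + 1)]
      exact add_le_add_right (pairStep_mono ih g) _
  have hFle : ∀ n g, F n g ≤ h g := fun n g => by
    have h1 := hFdec n g
    have h2 := pairStep_iterate_nonneg h0 n g
    have h3 := hF0 n (c⁻¹ * g)
    linarith
  obtain ⟨Q, hQ, hFQ⟩ := exists_tendsto_of_monotone hFmono hFle
  have hQA : ∀ g, Q g = h (a⁻¹ * (b⁻¹ * g)) + pairStep Q g := fun g => by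
    have h1 := (tendsto_add_atTop_iff_nat 1).2 (hQ g)
    have h2 := (tendsto_const_nhds (x := h (a⁻¹ * (b⁻¹ * g)))).add (tendsto_pairStep hQ g)
    simp only [hFsucc] at h1
    exact tendsto_nhds_unique h1 h2
  have hQdec : ∀ g, Even (g.x + g.y + e) → h g = Q g + Q (c⁻¹ * g) := fun g hg => by
    have h1 := (he g hg).add ((hQ g).add (hQ (c⁻¹ * g)))
    simp only [← hFdec, zero_add] at h1
    exact tendsto_nhds_unique tendsto_const_nhds h1
  -- Two-step harmonicity of `Q`: by `step_step` the mixed pairs contribute `Q + Q ∘ c⁻¹` at `a⁻¹ *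
  -- (b⁻¹ * g)`, which is `h` there by `hQdec`, and `hQA` concludes.
  obtain ⟨θ, hθ⟩ := hh.exists_eq_mul_of_even e (u := Q)
    (fun g => (hF0 0 g).trans (hFQ 0 g)) (fun g => le_of_tendsto' (hQ g) fun n => hFle n g)
    (fun g hg => by
      have h1 := hQdec (a⁻¹ * (b⁻¹ * g)) (by rwa [even_a_inv_mul, even_b_inv_mul, not_not])
      rw [step_step]
      have hc : a⁻¹ * (b⁻¹ * (c⁻¹ * g)) = c⁻¹ * (a⁻¹ * (b⁻¹ * g)) := by
        rw [eq_inv_mul_iff_mul_eq, ← central_mul_mul, ← central_mul_mul, mul_inv_cancel_left]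
      have h2 := hQA g
      rw [hc]
      linarith)
  have hceven : ∀ g, Even (g.x + g.y + e) → Even ((c⁻¹ * g).x + (c⁻¹ * g).y + e) :=
    fun g hg => by
      obtain ⟨x, y, z⟩ := g
      rwa [c_inv_mul]
  have hmul : ∀ g, h g = θ * (h g + h (c⁻¹ * g)) := by
    have hev : ∀ g, Even (g.x + g.y + e) → h g = θ * (h g + h (c⁻¹ * g)) := fun g hg => by
      have h1 := hQdec g hg
      rw [hθ g hg, hθ _ (hceven g hg)] at h1
      linarith
    intro g
    by_cases hg : Even (g.x + g.y + e)
    · exact hev g hg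
    -- On the other parity, both neighbours of `g` lie in the good class; add their identities and
    -- use harmonicity.
    · have h1 := hev _ ((even_a_inv_mul e g).2 hg)
      have h2 := hev _ ((even_b_inv_mul e g).2 hg)
      have hc : ∀ s g : Heisenberg, c⁻¹ * (s * g) = s * (c⁻¹ * g) := fun s g => by
        rw [inv_mul_eq_iff_eq_mul, ← central_mul_mul, mul_inv_cancel_left]
      rw [hc] at h1 h2
      have h3 := hst g
      have h4 := hst (c⁻¹ * g)
      simp only [step] at h3 h4
      rw [h4]
      linear_combination (1 - θ) * h3 + h1 + h2
  obtain ⟨g₁, hg₁⟩ := Function.ne_iff.1 hh.1.2.1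
  have hpos : 0 < h g₁ := lt_of_le_of_ne (h0 g₁) (Ne.symm hg₁)
  have hθ0 : 0 < θ := by
    by_contra! h1
    have h2 := mul_nonpos_of_nonpos_of_nonneg h1 (add_nonneg (h0 g₁) (h0 (c⁻¹ * g₁)))
    rw [← hmul] at h2
    linarith
  have hc : ∀ g, θ * h g = (1 - θ) * h (c * g) := fun g => by
    have h1 := hmul (c * g)
    rw [inv_mul_cancel_left] at h1
    linarith
  have hθ1 : 0 < 1 - θ := by
    by_contra! h1
    have h2 := mul_nonpos_of_nonpos_of_nonneg h1 (h0 (c * g₁))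
    rw [← hc] at h2
    linarith [mul_pos hθ0 hpos]
  refine ⟨θ / (1 - θ), div_pos hθ0 hθ1, fun g => ?_⟩
  have := hc g
  field_simp
  linarith

/-! ### The scalar is `1` -/

theorem a_inv_pow_b_inv (n : ℕ) (g : Heisenberg) :
    a⁻¹ ^ n * (b⁻¹ * g) = c ^ n * (b⁻¹ * (a⁻¹ ^ n * g)) := by
  induction n with
  | zero => simp
  | succ n ih =>
    have hc : ∀ s : Heisenberg, a⁻¹ * (c ^ n * s) = c ^ n * (a⁻¹ * s) := fun s => by
      rw [← mul_assoc, ← mul_assoc, ((show Commute a⁻¹ c from mul_c_comm _).pow_right n).eq]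
    rw [pow_succ', mul_assoc, ih, hc, ba_inv_eq, mul_assoc a⁻¹, pow_succ c, mul_assoc]

/-- If `l > 1`, a bound `h (a⁻¹ * g) ≤ ρ * h g` improves itself to `ρ * l⁻¹`. Indeed `a⁻ⁿ b⁻¹ = cⁿ
b⁻¹ a⁻ⁿ` gives `h (b⁻¹ a⁻ⁿ g) ≤ (ρ / l)ⁿ h (b⁻¹ g)`. As `h (a⁻ⁿ g)` tends to 0, `h g` is the sum of
the `h (b⁻¹ a⁻ⁿ g)`, so `(1 - ρ / l) * h g ≤ h (b⁻¹ g) = h g - h (a⁻¹ g)`. Iterating forces `h (a⁻¹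
g) = 0` for all `g`. -/
theorem IsMinimal.central_scalar_le_one {h : Heisenberg → ℝ} (hh : IsMinimal h)
    (hA : ∀ g, Tendsto (fun n : ℕ => h (a⁻¹ ^ n * g)) atTop (𝓝 0))
    {l : ℝ} (hl : ∀ g, h (c * g) = l * h g) : l ≤ 1 := by
  have h0 := hh.1.1
  have hst := hh.1.2.2
  by_contra! hl1
  have hl0 : 0 < l := one_pos.trans hl1
  have hln : ∀ (n : ℕ) g, h (c ^ n * g) = l ^ n * h g := by
    intro n
    induction n with
    | zero => simp
    | succ n ih => intro g; rw [pow_succ', mul_assoc, hl, ih, pow_succ']; ring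
  have hkey : ∀ m : ℕ, ∀ g, h (a⁻¹ * g) ≤ (l⁻¹) ^ m * h g := by
    intro m
    induction m with
    | zero =>
      intro g
      rw [hst g, step]
      simpa using h0 _
    | succ m ih =>
      set ρ := l⁻¹ ^ m
      have hρ0 : 0 < ρ := by positivity
      have hρ1 : ρ ≤ 1 := pow_le_one₀ (by positivity) (inv_le_one_of_one_le₀ hl1.le)
      have hx0 : 0 < ρ * l⁻¹ := by positivity
      have hx1 : ρ * l⁻¹ < 1 := by
        have := inv_lt_one_of_one_lt₀ hl1
        nlinarith [inv_pos.2 hl0]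
      have hpow : ∀ (n : ℕ) g, h (a⁻¹ ^ n * g) ≤ ρ ^ n * h g := by
        intro n
        induction n with
        | zero => simp
        | succ n ihn =>
          intro g
          rw [pow_succ' a⁻¹, mul_assoc]
          refine (ih _).trans ?_
          rw [pow_succ' ρ, mul_assoc]
          exact mul_le_mul_of_nonneg_left (ihn g) hρ0.le
      have hterm : ∀ (n : ℕ) g, h (b⁻¹ * (a⁻¹ ^ n * g)) ≤ (ρ * l⁻¹) ^ n * h (b⁻¹ * g) := by
        intro n g
        have h1 := hpow n (b⁻¹ * g)
        rw [a_inv_pow_b_inv, hln] at h1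
        rw [mul_pow, inv_pow l, mul_right_comm, ← div_eq_mul_inv, le_div_iff₀ (pow_pos hl0 n)]
        linarith
      intro g
      -- Partial sums over the time of the first `b⁻¹`, with the geometric series multiplied out by
      -- `1 - ρ * l⁻¹`.
      have hsum : ∀ n : ℕ, (1 - ρ * l⁻¹) * h g ≤
          (1 - (ρ * l⁻¹) ^ n) * h (b⁻¹ * g) + (1 - ρ * l⁻¹) * h (a⁻¹ ^ n * g) := by
        intro n
        induction n with
        | zero => simp
        | succ n ihn =>
          have h1 := hterm n g
          have h2 := hst (a⁻¹ ^ n * g)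
          rw [step, ← mul_assoc a⁻¹, ← pow_succ'] at h2
          have h3 := mul_le_mul_of_nonneg_left h1 (sub_nonneg.2 hx1.le)
          rw [pow_succ (ρ * l⁻¹)]
          rw [h2] at ihn
          linarith
      have h1 := ((((tendsto_pow_atTop_nhds_zero_of_lt_one hx0.le hx1).const_sub 1).mul_const
        (h (b⁻¹ * g))).add ((hA g).const_mul (1 - ρ * l⁻¹)))
      have h2 := ge_of_tendsto' h1 hsum
      have h3 := hst g
      simp only [step] at h3
      rw [pow_succ]
      linarith
  have ha : ∀ g, h (a⁻¹ * g) = 0 := fun g => by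
    refine le_antisymm ?_ (h0 _)
    have h1 := (tendsto_pow_atTop_nhds_zero_of_lt_one (inv_nonneg.2 hl0.le)
      (inv_lt_one_of_one_lt₀ hl1)).mul_const (h g)
    rw [zero_mul] at h1
    exact ge_of_tendsto' h1 fun m => hkey m g
  refine hh.1.2.1 (funext fun g => ?_)
  simpa using ha (a * g)

/-- `swap` sends `c` to `c⁻¹`, hence the scalar `l` to `l⁻¹`, and both are at most 1. -/
theorem IsMinimal.apply_c_mul {h : Heisenberg → ℝ} (hh : IsMinimal h)
    (hA : ∀ g, Tendsto (fun n : ℕ => h (a⁻¹ ^ n * g)) atTop (𝓝 0))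
    (hB : ∀ g, Tendsto (fun n : ℕ => h (b⁻¹ ^ n * g)) atTop (𝓝 0)) (g : Heisenberg) :
    h (c * g) = h g := by
  obtain ⟨l, hl0, hl⟩ := hh.exists_central_scalar hA hB
  have h1 := hh.central_scalar_le_one hA hl
  have h2 := hh.comp_swap.central_scalar_le_one (l := l⁻¹)
    (fun g => by simpa only [Function.comp, swap_a_inv_pow_mul] using hB (swap g))
    (fun g => by
      have := hl (c⁻¹ * swap g)
      rw [mul_inv_cancel_left] at this
      rw [Function.comp_apply, Function.comp_apply, swap_mul, swap_c, this,
        inv_mul_cancel_left₀ hl0.ne'])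
  have h3 : l = 1 := le_antisymm h1 ((inv_le_one₀ hl0).1 h2)
  rw [hl, h3, one_mul]

/-! ### Minimal functions invariant under the centre, and the classification -/

theorem IsMinimal.exists_character {h : Heisenberg → ℝ} (hh : IsMinimal h)
    (hc : ∀ g, h (c * g) = h g) :
    ∃ r s : ℝ, 0 < r ∧ 0 < s ∧ 1 / r + 1 / s = 1 ∧ Proportional h (character r s) := by
  have h0 := hh.1.1
  have hst := hh.1.2.2
  obtain ⟨g₁, hg₁⟩ := Function.ne_iff.1 hh.1.2.1
  have hpos : 0 < h g₁ := lt_of_le_of_ne (h0 g₁) (Ne.symm hg₁)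
  -- Invariance under `c` makes the left translate by `a⁻¹` harmonic, although left translations do
  -- not commute with `step` in general.
  obtain ⟨θ, hθ⟩ := hh.2 (fun g => h (a⁻¹ * g)) (fun g => h0 _)
    (fun g => by rw [hst g]; exact le_add_of_nonneg_right (h0 _))
    (fun g => by
      simp only [step]
      rw [ba_inv_eq, hc]
      exact hst _)
  have hb : ∀ g, h (b⁻¹ * g) = (1 - θ) * h g := fun g => by
    have h1 := hst g
    have h2 := hθ g
    simp only [step] at h1 h2
    linarith
  have hθ0 : 0 < θ := by
    have h1 : 0 < θ * h (a * g₁) := by rw [← hθ, inv_mul_cancel_left]; exact hpos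
    by_contra! h2
    exact absurd h1 (not_lt.2 (mul_nonpos_of_nonpos_of_nonneg h2 (h0 _)))
  have hθ1 : 0 < 1 - θ := by
    have h1 : 0 < (1 - θ) * h (b * g₁) := by rw [← hb, inv_mul_cancel_left]; exact hpos
    by_contra! h2
    exact absurd h1 (not_lt.2 (mul_nonpos_of_nonpos_of_nonneg h2 (h0 _)))
  have key := eq_mul_character (inv_ne_zero hθ0.ne') (inv_ne_zero hθ1.ne') hc
    (fun g => by rw [inv_inv]; exact hθ g) (fun g => by rw [inv_inv]; exact hb g)
  refine ⟨θ⁻¹, (1 - θ)⁻¹, inv_pos.2 hθ0, inv_pos.2 hθ1, by simp, h 1, ?_, key⟩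
  refine lt_of_le_of_ne (h0 1) fun h1 => hpos.ne' ?_
  rw [key, ← h1, zero_mul]

end Heisenberg

theorem theorem1p1 (h : Heisenberg → ℝ) :
    Heisenberg.IsExtremal Heisenberg.southwest h ↔
      (∃ r s : ℝ, 0 < r ∧ 0 < s ∧ 1 / r + 1 / s = 1 ∧
        Heisenberg.Proportional h (Heisenberg.character r s)) ∨
      (∃ g₀ : Heisenberg,
        Heisenberg.Proportional h (Heisenberg.h₀ ∘ Heisenberg.rightTranslation g₀)) ∨
      (∃ g₀ : Heisenberg,
        Heisenberg.Proportional h (Heisenberg.h₁ ∘ Heisenberg.rightTranslation g₀)) := by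
  rw [Heisenberg.isExtremal_iff_isMinimal]
  constructor
  · intro hh
    rcases hh.proportional_h₀_or_tendsto with H | hA
    · exact Or.inr (Or.inl H)
    rcases hh.proportional_h₁_or_tendsto with H | hB
    · exact Or.inr (Or.inr H)
    exact Or.inl (hh.exists_character (hh.apply_c_mul hA hB))
  · rintro (⟨r, s, hr, hs, hrs, H⟩ | ⟨g₀, H⟩ | ⟨g₀, H⟩)
    · exact (Heisenberg.isMinimal_character hr hs hrs).of_proportional H
    · exact (Heisenberg.isMinimal_h₀.comp_rightTranslation g₀).of_proportional H
    · exact (Heisenberg.isMinimal_h₁.comp_rightTranslation g₀).of_proportional H
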